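/- Let $E$ be a complete, barrelled, Hausdorff locally convex space over $\mathbb K\in\{\mathbb R,\mathbb C\}$ with topological dual $E'$. Let $E''$ be the bidual of $E$, that is, the topological dual of $E'_\beta$, where $E'_\beta$ is $E'$ with the topology of uniform convergence on the bounded subsets of $E$. Let $x_j\in E$ and $x_j'\in E'$ $(j\in\mathbb N)$ be such that $(\{x_j'\},\{x_j\})$ is an unconditional atomic decomposition of $E$, i.e. for every $x\in E$ $$x=\sum_{j=1}^\infty x_j'(x)\,x_j$$ with unconditional convergence in $E$. Then $(\{x_j'\},\{x_j\})$ is boundedly complete, i.e. the series $\sum_{j=1}^\infty x''(x_j')\,x_j$ converges in $E$ for every $x''\in E''$, if and only if $E$ does not contain a copy of $c_0$, i.e. there is no linear topological isomorphism from the Banach space $c_0$ of null sequences in $\mathbb K$ (with the supremum norm) onto a subspace of $E$. -/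

import Mathlib

open Filter Topology
open scoped ZeroAtInfty

section AtomicDecomposition

variable {𝕜 E : Type*} [RCLike 𝕜] [AddCommGroup E] [Module 𝕜 E] [TopologicalSpace E]

/-- The pair `({x'_j}, {x_j})`, with `x'_j` in the topological dual of `E` and `x_j` in `E`, is an
atomic decomposition of `E` if `v = ∑_j x'_j(v) x_j` for all `v`, the sequence of partial sums
converging in `E`. -/
def IsAtomicDecomposition (x' : ℕ → StrongDual 𝕜 E) (x : ℕ → E) : Prop :=
  ∀ v : E, Tendsto (fun n : ℕ => ∑ j ∈ Finset.range n, x' j v • x j) atTop (𝓝 v)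

/-- An atomic decomposition is unconditional if every series `v = ∑_j x'_j(v) x_j` converges
unconditionally (`HasSum` is convergence of the net of all finite partial sums). -/
def IsUnconditionalAtomicDecomposition (x' : ℕ → StrongDual 𝕜 E) (x : ℕ → E) : Prop :=
  IsAtomicDecomposition x' x ∧ ∀ v : E, HasSum (fun j : ℕ => x' j v • x j) v

/-- An atomic decomposition is boundedly complete if `∑_j x''(x'_j) x_j` converges in `E` for every
`x''` in the bidual of `E`. The bidual is the dual of the strong dual: the topology that Mathlib
puts on `StrongDual 𝕜 E` is that of uniform convergence on the bounded subsets of `E`. -/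
def IsBoundedlyCompleteAtomicDecomposition [IsTopologicalAddGroup E] [ContinuousSMul 𝕜 E]
    (x' : ℕ → StrongDual 𝕜 E) (x : ℕ → E) : Prop :=
  IsAtomicDecomposition x' x ∧
    ∀ x'' : StrongDual 𝕜 (StrongDual 𝕜 E), ∃ s : E,
      Tendsto (fun n : ℕ => ∑ j ∈ Finset.range n, x'' (x' j) • x j) atTop (𝓝 s)

variable (𝕜 E) in
/-- `E` contains a copy of `c_0`: there is a linear topological isomorphism from `c_0` onto a
subspace of `E`. Here `c_0` is the space `C₀(ℕ, 𝕜)` of null sequences with the supremum norm. -/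
def ContainsCopyOfC0 : Prop :=
  ∃ T : C₀(ℕ, 𝕜) →L[𝕜] E, IsEmbedding T

end AtomicDecomposition

/-! Both implications rest on Rosenthal's disjointification lemma. Suppose some series `∑ x''(x'_j)
x_j` is not unconditionally Cauchy: it has disjoint finite blocks `y_k` with `p (y_k) ≥ 1` for a
continuous seminorm `p`. By barrelledness the finite partial-sum operators are equicontinuous, so
their adjoints keep equicontinuous sets of functionals inside sets on which `x''` is bounded. Hence
`∑ |u(y_k)|` is bounded uniformly on equicontinuous sets. Rosenthal's lemma, applied to norming
functionals of the `y_k`, gives a subsequence spanning a copy of `c₀`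
(`containsCopyOfC0_of_sum_norm_le`). Conversely, let `T` embed `c₀` in a space with a boundedly
complete decomposition. Summing the series of `T''(𝟙_A)` gives a bounded finitely additive `S : Set
ℕ → E` with `S {n} = T e_n`. Rosenthal's lemma then produces uncountably many uniformly separated
values of `S`, although an atomic decomposition makes `E` separable
(`not_separableSpace_of_additive`). -/

/-! ### Auxiliary facts on seminorms and sums -/

section Polynormable

variable {𝕜 E : Type*} [RCLike 𝕜] [AddCommGroup E] [Module 𝕜 E] [TopologicalSpace E]
  [PolynormableSpace 𝕜 E]

variable (𝕜) in
/-- In a polynormable space, every neighbourhood of zero contains the open unit ball of a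
continuous seminorm. -/
theorem exists_continuous_seminorm_lt_one_imp_mem {U : Set E} (hU : U ∈ 𝓝 (0 : E)) :
    ∃ p : Seminorm 𝕜 E, Continuous p ∧ ∀ v, p v < 1 → v ∈ U := by
  have hw := PolynormableSpace.withSeminorms 𝕜 E
  have := hw.topologicalAddGroup
  obtain ⟨⟨s, r⟩, hr, hs⟩ := hw.hasBasis_zero_ball.mem_iff.1 hU
  simp only at hr hs
  refine ⟨Real.toNNReal r⁻¹ • s.sup fun p => p.1,
    Continuous.const_smul (Seminorm.continuous_finsetSup fun i _ => i.2) _, fun v hv => hs ?_⟩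
  rw [Seminorm.mem_ball_zero]
  have hv' : (Real.toNNReal r⁻¹ : ℝ) * (s.sup fun p => p.1) v < 1 := hv
  rw [Real.coe_toNNReal _ (by positivity)] at hv'
  rwa [inv_mul_lt_iff₀ hr, mul_one] at hv'

/-- A norming functional for a continuous seminorm at a given vector. -/
theorem Seminorm.exists_strongDual_apply_eq {p : Seminorm 𝕜 E} (hp : Continuous p) (v : E) :
    ∃ u : StrongDual 𝕜 E, (∀ w, ‖u w‖ ≤ p w) ∧ u v = (p v : 𝕜) := by
  by_cases hv : p v = 0
  · exact ⟨0, fun w => by simp, by simp [hv]⟩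
  have hv0 : v ≠ 0 := fun h => hv (by simp [h])
  let e := LinearEquiv.toSpanNonzeroSingleton 𝕜 E v hv0
  obtain ⟨u, hu, hup⟩ := Module.Dual.exists_continuous_extension_of_le_seminorm (𝕜 := 𝕜)
    (Submodule.span 𝕜 {v}) ((p v : 𝕜) • (e.symm : _ →ₗ[𝕜] 𝕜)) hp (by
      intro w
      obtain ⟨c, rfl⟩ := e.surjective w
      have : ((e c : Submodule.span 𝕜 {v}) : E) = c • v := rfl
      rw [this, map_smul_eq_mul, LinearMap.smul_apply, norm_smul, mul_comm]
      simp [abs_of_nonneg (apply_nonneg p v)])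
  refine ⟨u, hup, ?_⟩
  have h1 : ((e 1 : Submodule.span 𝕜 {v}) : E) = v := one_smul 𝕜 v
  have := hu (e 1)
  rw [h1, LinearMap.smul_apply, smul_eq_mul] at this
  simpa using this

end Polynormable

/-- If all partial sums of a finite family of scalars have norm at most `C`, then the norms sum up
to at most `4 * C`. -/
theorem Finset.sum_norm_le_four_mul {𝕜 ι : Type*} [RCLike 𝕜] {z : ι → 𝕜} {F : Finset ι} {C : ℝ}
    (h : ∀ G ⊆ F, ‖∑ i ∈ G, z i‖ ≤ C) : ∑ i ∈ F, ‖z i‖ ≤ 4 * C := by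
  -- Splitting by sign costs a factor 2, and real and imaginary parts another 2.
  have real : ∀ r : ι → ℝ, (∀ G ⊆ F, |∑ i ∈ G, r i| ≤ C) → ∑ i ∈ F, |r i| ≤ 2 * C := by
    intro r hr
    have h1 := abs_le.1 (hr _ (Finset.filter_subset (fun i => 0 ≤ r i) F))
    have h2 := abs_le.1 (hr _ (Finset.filter_subset (fun i => ¬ 0 ≤ r i) F))
    rw [← Finset.sum_filter_add_sum_filter_not F (fun i => 0 ≤ r i)]
    have e1 : ∑ i ∈ F with 0 ≤ r i, |r i| = ∑ i ∈ F with 0 ≤ r i, r i :=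
      Finset.sum_congr rfl fun i hi => abs_of_nonneg (Finset.mem_filter.1 hi).2
    have e2 : ∑ i ∈ F with ¬ 0 ≤ r i, |r i| = -∑ i ∈ F with ¬ 0 ≤ r i, r i := by
      rw [← Finset.sum_neg_distrib]
      exact Finset.sum_congr rfl fun i hi => abs_of_neg (not_le.1 (Finset.mem_filter.1 hi).2)
    rw [e1, e2]
    linarith
  have hre := real (fun i => RCLike.re (z i)) fun G hG => by
    rw [← map_sum]; exact (RCLike.abs_re_le_norm _).trans (h G hG)
  have him := real (fun i => RCLike.im (z i)) fun G hG => by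
    rw [← map_sum]; exact (RCLike.abs_im_le_norm _).trans (h G hG)
  calc ∑ i ∈ F, ‖z i‖ ≤ ∑ i ∈ F, (|RCLike.re (z i)| + |RCLike.im (z i)|) :=
        Finset.sum_le_sum fun i _ => by
          refine (sq_le_sq₀ (norm_nonneg _) (by positivity)).1 ?_
          rw [← RCLike.normSq_eq_def', RCLike.normSq_apply, add_sq, sq_abs, sq_abs]
          have := mul_nonneg (abs_nonneg (RCLike.re (z i))) (abs_nonneg (RCLike.im (z i)))
          linarith
    _ ≤ 4 * C := by rw [Finset.sum_add_distrib]; linarith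

/-! ### Rosenthal's lemma -/

/-- **Rosenthal's lemma** for superadditive set functions, after Kupka. -/
theorem exists_injective_apply_range_diff_singleton_le {ν : ℕ → Set ℕ → ℝ} {M ε : ℝ}
    (hε : 0 < ε) (h0 : ∀ n A, 0 ≤ ν n A)
    (hadd : ∀ n A B, Disjoint A B → ν n A + ν n B ≤ ν n (A ∪ B))
    (hM : ∀ n A, ν n A ≤ M) :
    ∃ ψ : ℕ → ℕ, ψ.Injective ∧ ∀ k, ν (ψ k) (Set.range ψ \ {ψ k}) ≤ ε := by
  have mono : ∀ n A B, A ⊆ B → ν n A ≤ ν n B := fun n A B h => by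
    have := hadd n A (B \ A) Set.disjoint_sdiff_right
    rw [Set.union_sdiff_cancel h] at this
    linarith [h0 n (B \ A)]
  -- Induction on the total mass of `range φ`, counted in units of `ε`.
  have key : ∀ m : ℕ, ∀ φ : ℕ → ℕ, φ.Injective → (∀ k, ν (φ k) (Set.range φ) ≤ m * ε) →
      ∃ ψ : ℕ → ℕ, ψ.Injective ∧ ∀ k, ν (ψ k) (Set.range ψ \ {ψ k}) ≤ ε := by
    intro m
    induction m with
    | zero =>
      intro φ hφ h
      refine ⟨φ, hφ, fun k => (mono _ _ _ Set.sdiff_subset).trans ((h k).trans ?_)⟩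
      simpa using hε.le
    | succ m ih =>
      intro φ hφ h
      -- The pairing function cuts `range φ` into infinitely many infinite pieces.
      let φ' : ℕ → ℕ → ℕ := fun i j => φ (Nat.pair i j)
      have hφ' : ∀ i j i' j', φ' i j = φ' i' j' → i = i' ∧ j = j' := fun i j i' j' hij =>
        Nat.pair_eq_pair.1 (hφ hij)
      by_cases hgood : ∃ i, ∀ j, ν (φ' i j) (Set.range (φ' i) \ {φ' i j}) ≤ ε
      · obtain ⟨i, hi⟩ := hgood
        exact ⟨φ' i, fun j j' hj => (hφ' _ _ _ _ hj).2, hi⟩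
      push Not at hgood
      choose j hj using hgood
      -- If every piece fails at some point `j i`, these points form a transversal. It misses the
      -- rest of piece `i`, which has mass above `ε`, so superadditivity lowers the bound by `ε`.
      refine ih (fun i => φ' i (j i)) (fun i i' hi => (hφ' _ _ _ _ hi).1) fun i => ?_
      have hdisj : Disjoint (Set.range fun i => φ' i (j i))
          (Set.range (φ' i) \ {φ' i (j i)}) := by
        rw [Set.disjoint_left]
        rintro _ ⟨i', rfl⟩ ⟨⟨l, hl⟩, hne⟩
        obtain ⟨rfl, rfl⟩ := hφ' _ _ _ _ hl
        exact hne rfl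
      have h1 := hadd (φ' i (j i)) _ _ hdisj
      have h2 : ν (φ' i (j i)) ((Set.range fun i => φ' i (j i)) ∪
          (Set.range (φ' i) \ {φ' i (j i)})) ≤ ν (φ' i (j i)) (Set.range φ) := by
        refine mono _ _ _ (Set.union_subset ?_ (Set.sdiff_subset.trans ?_)) <;>
        · rintro _ ⟨l, rfl⟩
          exact ⟨_, rfl⟩
      have h3 := h (Nat.pair i (j i))
      have h4 := hj i
      push_cast at h3
      change ν (φ' i (j i)) (Set.range φ) ≤ _ at h3
      linarith
  obtain ⟨m, hm⟩ := exists_nat_ge (M / ε)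
  exact key m id Function.injective_id fun k => (hM _ _).trans ((div_le_iff₀ hε).1 hm)

/-- **Rosenthal's lemma** for uniformly bounded finitely additive real set functions. -/
theorem exists_injective_abs_apply_le_of_additive {g : ℕ → Set ℕ → ℝ} {M ε : ℝ}
    (hε : 0 < ε) (hadd : ∀ n A B, Disjoint A B → g n (A ∪ B) = g n A + g n B)
    (hM : ∀ n A, |g n A| ≤ M) :
    ∃ ψ : ℕ → ℕ, ψ.Injective ∧ ∀ k, ∀ B ⊆ Set.range ψ \ {ψ k}, |g (ψ k) B| ≤ ε := by
  have hempty : ∀ n, g n ∅ = 0 := fun n => by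
    have := hadd n ∅ ∅ (Set.disjoint_empty _)
    rw [Set.union_empty] at this
    linarith
  -- The supremum of `V n A` is a superadditive variation of `g n`; taking `B` or `C` empty recovers
  -- bounds on both signs.
  let V : ℕ → Set ℕ → Set ℝ := fun n A => {t | ∃ B ⊆ A, ∃ C ⊆ A, t = g n B - g n C}
  have hVle : ∀ n A, ∀ t ∈ V n A, t ≤ 2 * M := by
    rintro n A t ⟨B, -, C, -, rfl⟩
    linarith [(abs_le.1 (hM n B)).2, (abs_le.1 (hM n C)).1]
  have hVbdd : ∀ n A, BddAbove (V n A) := fun n A => ⟨2 * M, hVle n A⟩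
  have hV0 : ∀ n A, (0 : ℝ) ∈ V n A := fun n A =>
    ⟨∅, Set.empty_subset _, ∅, Set.empty_subset _, by simp⟩
  obtain ⟨ψ, hψ, h⟩ := exists_injective_apply_range_diff_singleton_le
    (ν := fun n A => sSup (V n A)) (M := 2 * M) hε
    (fun n A => le_csSup (hVbdd n A) (hV0 n A))
    (fun n A B hAB => by
      rw [← csSup_add ⟨0, hV0 n A⟩ (hVbdd n A) ⟨0, hV0 n B⟩ (hVbdd n B)]
      refine csSup_le_csSup (hVbdd n _) ⟨0, 0, hV0 n A, 0, hV0 n B, by simp⟩ ?_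
      rintro _ ⟨_, ⟨B₁, hB₁, C₁, hC₁, rfl⟩, _, ⟨B₂, hB₂, C₂, hC₂, rfl⟩, rfl⟩
      refine ⟨B₁ ∪ B₂, Set.union_subset_union hB₁ hB₂, C₁ ∪ C₂,
        Set.union_subset_union hC₁ hC₂, ?_⟩
      rw [hadd n _ _ (hAB.mono hB₁ hB₂), hadd n _ _ (hAB.mono hC₁ hC₂)]
      simp only
      ring)
    (fun n A => csSup_le ⟨0, hV0 n A⟩ (hVle n A))
  refine ⟨ψ, hψ, fun k B hB => abs_le.2 ⟨?_, ?_⟩⟩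
  · have : g (ψ k) ∅ - g (ψ k) B ≤ ε :=
      (le_csSup (hVbdd _ _) ⟨∅, Set.empty_subset _, B, hB, rfl⟩).trans (h k)
    rw [hempty] at this
    linarith
  · have : g (ψ k) B - g (ψ k) ∅ ≤ ε :=
      (le_csSup (hVbdd _ _) ⟨B, hB, ∅, Set.empty_subset _, rfl⟩).trans (h k)
    rwa [hempty, sub_zero] at this

/-! ### Building a copy of `c₀` -/

section CopyOfC0

/-- Test the sum on a norming functional. The hypothesis `hC` is weak unconditional Cauchyness, made
uniform on the polar of `q`. -/
theorem Seminorm.apply_sum_smul_le {𝕜 E : Type*} [RCLike 𝕜] [AddCommGroup E] [Module 𝕜 E]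
    [TopologicalSpace E] [PolynormableSpace 𝕜 E] {q : Seminorm 𝕜 E} (hq : Continuous q)
    {ι : Type*} {y : ι → E} {C : ℝ}
    (hC : ∀ u : StrongDual 𝕜 E, (∀ v, ‖u v‖ ≤ q v) → ∀ F : Finset ι, ∑ k ∈ F, ‖u (y k)‖ ≤ C)
    (F : Finset ι) {a : ι → 𝕜} {δ : ℝ} (hδ : 0 ≤ δ) (ha : ∀ k ∈ F, ‖a k‖ ≤ δ) :
    q (∑ k ∈ F, a k • y k) ≤ δ * C := by
  obtain ⟨u, hu, huv⟩ := Seminorm.exists_strongDual_apply_eq hq (𝕜 := 𝕜) (∑ k ∈ F, a k • y k)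
  have h1 : q (∑ k ∈ F, a k • y k) = ‖u (∑ k ∈ F, a k • y k)‖ := by
    rw [huv]; simp [abs_of_nonneg (apply_nonneg q _)]
  rw [h1, map_sum]
  calc ‖∑ k ∈ F, u (a k • y k)‖ ≤ ∑ k ∈ F, δ * ‖u (y k)‖ :=
        norm_sum_le_of_le _ fun k hk => by
          rw [map_smul, norm_smul]
          exact mul_le_mul_of_nonneg_right (ha k hk) (norm_nonneg _)
    _ = δ * ∑ k ∈ F, ‖u (y k)‖ := (Finset.mul_sum _ _ _).symm
    _ ≤ δ * C := mul_le_mul_of_nonneg_left (hC u hu F) hδ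

variable {𝕜 E : Type*} [RCLike 𝕜] [AddCommGroup E] [Module 𝕜 E] [UniformSpace E]
  [IsUniformAddGroup E] [PolynormableSpace 𝕜 E]

theorem ZeroAtInftyContinuousMap.norm_apply_le {α β : Type*} [TopologicalSpace α]
    [SeminormedAddCommGroup β] (a : C₀(α, β)) (x : α) : ‖a x‖ ≤ ‖a‖ :=
  a.toBCF.norm_coe_le_norm x

theorem ZeroAtInftyContinuousMap.norm_le {α β : Type*} [TopologicalSpace α]
    [SeminormedAddCommGroup β] {a : C₀(α, β)} {C : ℝ} (hC : 0 ≤ C) :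
    ‖a‖ ≤ C ↔ ∀ x, ‖a x‖ ≤ C :=
  BoundedContinuousFunction.norm_le (f := a.toBCF) hC

theorem summable_smul_of_sum_norm_le [CompleteSpace E] {y : ℕ → E}
    (hy : ∀ q : Seminorm 𝕜 E, Continuous q → ∃ C, ∀ u : StrongDual 𝕜 E, (∀ v, ‖u v‖ ≤ q v) →
      ∀ F : Finset ℕ, ∑ k ∈ F, ‖u (y k)‖ ≤ C) (a : C₀(ℕ, 𝕜)) :
    Summable fun k => a k • y k := by
  rw [summable_iff_vanishing]
  intro U hU
  obtain ⟨q, hq, hqU⟩ := exists_continuous_seminorm_lt_one_imp_mem 𝕜 hU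
  obtain ⟨C, hC⟩ := hy q hq
  have hC0 : 0 ≤ C := by simpa using hC 0 (by simp) ∅
  have hlim : Tendsto (fun k => a k) cofinite (𝓝 0) := by
    rw [← Filter.cocompact_eq_cofinite]
    exact a.zero_at_infty'
  have hev : ∀ᶠ k in cofinite, ‖a k‖ < (2 * (C + 1))⁻¹ := by
    have := hlim.norm
    rw [norm_zero] at this
    exact this.eventually_lt_const (by positivity)
  refine ⟨(Filter.eventually_cofinite.1 hev).toFinset, fun F hF => hqU _ ?_⟩
  have := Seminorm.apply_sum_smul_le hq hC F (a := a) (δ := (2 * (C + 1))⁻¹) (by positivity)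
    fun k hk => by
      by_contra hcon
      exact Finset.disjoint_left.1 hF hk (by simpa using (not_le.1 hcon).le)
  refine this.trans_lt ?_
  rw [inv_mul_lt_iff₀ (by positivity)]
  linarith

variable [T2Space E]

/-- The embedding is `a ↦ ∑ a_k y_k`. Continuity comes from `hy`; diagonal dominance gives `|a_k| ≤
p(T a) + ‖a‖ / 2`, and the supremum over `k` yields `‖a‖ ≤ 2 p(T a)`. -/
theorem containsCopyOfC0_of_biorthogonal_bound [CompleteSpace E] {y : ℕ → E}
    (hy : ∀ q : Seminorm 𝕜 E, Continuous q → ∃ C, ∀ u : StrongDual 𝕜 E, (∀ v, ‖u v‖ ≤ q v) →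
      ∀ F : Finset ℕ, ∑ k ∈ F, ‖u (y k)‖ ≤ C)
    {p : Seminorm 𝕜 E} (hp : Continuous p) {u : ℕ → StrongDual 𝕜 E}
    (hu : ∀ k v, ‖u k v‖ ≤ p v) (huy : ∀ k, 1 ≤ ‖u k (y k)‖)
    (hoff : ∀ k, ∀ F : Finset ℕ, k ∉ F → ∑ j ∈ F, ‖u k (y j)‖ ≤ 1 / 2) :
    ContainsCopyOfC0 𝕜 E := by
  have := (PolynormableSpace.withSeminorms 𝕜 E).continuousSMul
  have hs := summable_smul_of_sum_norm_le hy
  let T₀ : C₀(ℕ, 𝕜) →ₗ[𝕜] E :=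
    { toFun := fun a => ∑' k, a k • y k
      map_add' := fun a b => by
        simp only [ZeroAtInftyContinuousMap.add_apply, add_smul]
        exact (hs a).tsum_add (hs b)
      map_smul' := fun c a => by
        simp only [ZeroAtInftyContinuousMap.smul_apply, smul_assoc, RingHom.id_apply]
        exact (hs a).tsum_const_smul c }
  have hT₀ : ∀ a, HasSum (fun k => a k • y k) (T₀ a) := fun a => (hs a).hasSum
  have hcont : Continuous T₀ := by
    refine continuous_of_continuousAt_zero T₀ ?_
    rw [ContinuousAt, map_zero]
    intro U hU
    obtain ⟨q, hq, hqU⟩ := exists_continuous_seminorm_lt_one_imp_mem 𝕜 hU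
    obtain ⟨C, hC⟩ := hy q hq
    have hb : ∀ a, q (T₀ a) ≤ ‖a‖ * C := fun a =>
      le_of_tendsto ((hq.tendsto _).comp (hT₀ a)) (Eventually.of_forall fun F =>
        Seminorm.apply_sum_smul_le hq hC F (norm_nonneg a) fun k _ => a.norm_apply_le k)
    have hlim : Tendsto (fun a : C₀(ℕ, 𝕜) => ‖a‖ * C) (𝓝 0) (𝓝 0) := by
      simpa using (tendsto_norm_zero (E := C₀(ℕ, 𝕜))).mul_const C
    refine Filter.mem_map.2 ?_
    filter_upwards [hlim.eventually_lt_const one_pos] with a ha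
    exact hqU _ ((hb a).trans_lt ha)
  have hlow : ∀ a, ‖a‖ ≤ 2 * p (T₀ a) := by
    intro a
    suffices ‖a‖ ≤ p (T₀ a) + ‖a‖ / 2 by linarith
    rw [ZeroAtInftyContinuousMap.norm_le (by positivity)]
    intro k
    have h1 : Tendsto (fun F : Finset ℕ => ‖u k (∑ j ∈ F, a j • y j)‖ + ‖a‖ / 2) atTop
        (𝓝 (‖u k (T₀ a)‖ + ‖a‖ / 2)) :=
      ((((u k).continuous.tendsto _).comp (hT₀ a)).norm).add_const _
    refine (ge_of_tendsto h1 ?_).trans (add_le_add_left (hu k _) _)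
    filter_upwards [eventually_ge_atTop {k}] with F hF
    have hk : k ∈ F := Finset.singleton_subset_iff.1 hF
    rw [← Finset.add_sum_erase F _ hk, map_add, map_smul, map_sum]
    have h2 : ‖∑ j ∈ F.erase k, u k (a j • y j)‖ ≤ ‖a‖ / 2 :=
      calc ‖∑ j ∈ F.erase k, u k (a j • y j)‖ ≤ ∑ j ∈ F.erase k, ‖a‖ * ‖u k (y j)‖ :=
            norm_sum_le_of_le _ fun j _ => by
              rw [map_smul, norm_smul]
              exact mul_le_mul_of_nonneg_right (a.norm_apply_le j) (norm_nonneg _)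
        _ = ‖a‖ * ∑ j ∈ F.erase k, ‖u k (y j)‖ := (Finset.mul_sum _ _ _).symm
        _ ≤ ‖a‖ * (1 / 2) :=
            mul_le_mul_of_nonneg_left (hoff k _ (Finset.notMem_erase k F)) (norm_nonneg a)
        _ = ‖a‖ / 2 := by ring
    have h3 : ‖a k‖ ≤ ‖a k • u k (y k)‖ := by
      rw [norm_smul]
      exact le_mul_of_one_le_right (norm_nonneg _) (huy k)
    have h4 := norm_sub_le_norm_add (a k • u k (y k)) (∑ j ∈ F.erase k, u k (a j • y j))
    linarith
  refine ⟨⟨T₀, hcont⟩, ?_⟩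
  have hind : IsInducing T₀ := by
    rw [IsTopologicalAddGroup.isInducing_iff_nhds_zero]
    refine le_antisymm (Filter.map_le_iff_le_comap.1 ?_) ?_
    · simpa using! hcont.tendsto 0
    · have h0 : Tendsto (fun a => 2 * p (T₀ a)) (comap T₀ (𝓝 0)) (𝓝 0) := by
        have := (hp.tendsto 0).comp (tendsto_comap (f := T₀) (x := 𝓝 0))
        simpa using this.const_mul 2
      exact squeeze_zero_norm hlow h0
  exact ⟨hind, hind.injective⟩

/-- A weakly unconditionally Cauchy series whose terms do not tend to zero yields a copy of
`c₀`. -/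
theorem containsCopyOfC0_of_sum_norm_le [CompleteSpace E] {y : ℕ → E}
    (hy : ∀ q : Seminorm 𝕜 E, Continuous q → ∃ C, ∀ u : StrongDual 𝕜 E, (∀ v, ‖u v‖ ≤ q v) →
      ∀ F : Finset ℕ, ∑ k ∈ F, ‖u (y k)‖ ≤ C)
    {p : Seminorm 𝕜 E} (hp : Continuous p) (hpy : ∀ k, 1 ≤ p (y k)) :
    ContainsCopyOfC0 𝕜 E := by
  choose u hu huy using fun k => Seminorm.exists_strongDual_apply_eq hp (𝕜 := 𝕜) (y k)
  obtain ⟨C, hC⟩ := hy p hp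
  have hsum : ∀ k, Summable fun j => ‖u k (y j)‖ := fun k =>
    summable_of_sum_le (fun _ => norm_nonneg _) (hC (u k) (hu k))
  have hsumA : ∀ k (A : Set ℕ), Summable (A.indicator fun j => ‖u k (y j)‖) := fun k A =>
    (hsum k).indicator A
  have hnn : ∀ k (A : Set ℕ) j, 0 ≤ A.indicator (fun j => ‖u k (y j)‖) j := fun k A j =>
    Set.indicator_nonneg (fun _ _ => norm_nonneg _) j
  -- Rosenthal's lemma for the measures with mass `|u_k(y_j)|` at `j` makes the off-diagonal sums
  -- small.
  obtain ⟨ψ, hψ, h⟩ := exists_injective_apply_range_diff_singleton_le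
    (ν := fun k A => ∑' j, A.indicator (fun j => ‖u k (y j)‖) j) (M := C) (ε := 1 / 2)
    (by norm_num) (fun k A => tsum_nonneg (hnn k A))
    (fun k A B hAB => by
      rw [Set.indicator_union_of_disjoint hAB]
      exact ((hsumA k A).tsum_add (hsumA k B)).ge)
    (fun k A => (hsumA k A).tsum_le_of_sum_le fun F =>
      (Finset.sum_le_sum fun j _ =>
        Set.indicator_le_self' (fun _ _ => norm_nonneg _) j).trans (hC _ (hu k) F))
  refine containsCopyOfC0_of_biorthogonal_bound (y := y ∘ ψ) (u := u ∘ ψ) ?_ hp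
    (fun k => hu (ψ k)) (fun k => ?_) (fun k F hkF => ?_)
  · intro q hq
    obtain ⟨C, hC⟩ := hy q hq
    refine ⟨C, fun u hu F => ?_⟩
    simpa using hC u hu (F.map ⟨ψ, hψ⟩)
  · simp only [Function.comp_apply, huy]
    simpa [abs_of_nonneg (apply_nonneg p _)] using hpy (ψ k)
  · refine le_trans (le_of_eq_of_le ?_ ((hsumA (ψ k) (Set.range ψ \ {ψ k})).sum_le_tsum
      (F.map ⟨ψ, hψ⟩) fun j _ => hnn _ _ j)) (h k)
    rw [Finset.sum_map]
    refine Finset.sum_congr rfl fun j hj => ?_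
    have : ψ j ∈ Set.range ψ \ {ψ k} :=
      ⟨⟨j, rfl⟩, fun he => hkF (hψ he ▸ hj)⟩
    simp only [Function.Embedding.coeFn_mk, Set.indicator_of_mem this, Function.comp_apply]

end CopyOfC0

/-! ### Atomic decompositions and the bidual -/

section Bidual

section TopologicalSpace

variable {𝕜 E : Type*} [RCLike 𝕜] [AddCommGroup E] [Module 𝕜 E] [TopologicalSpace E]
  {x' : ℕ → StrongDual 𝕜 E} {x : ℕ → E}

/-- The functional `∑ u(x_j) x'_j` is `u` composed with the partial-sum operator of `F`. -/
theorem StrongDual.norm_sum_smul_apply_le {q r : Seminorm 𝕜 E} {F : Finset ℕ}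
    (hF : ∀ v, q (∑ j ∈ F, x' j v • x j) ≤ r v) {u : StrongDual 𝕜 E} (hu : ∀ v, ‖u v‖ ≤ q v)
    (v : E) : ‖(∑ j ∈ F, u (x j) • x' j) v‖ ≤ r v := by
  have : (∑ j ∈ F, u (x j) • x' j) v = u (∑ j ∈ F, x' j v • x j) := by
    simp [mul_comm]
  rw [this]
  exact (hu _).trans (hF v)

theorem StrongDual.apply_sum_bidual_smul (x'' : StrongDual 𝕜 (StrongDual 𝕜 E)) (F : Finset ℕ)
    (u : StrongDual 𝕜 E) :
    u (∑ j ∈ F, x'' (x' j) • x j) = x'' (∑ j ∈ F, u (x j) • x' j) := by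
  simp [mul_comm]

/-- An element of the bidual is bounded on the polar of a neighbourhood of zero. -/
theorem StrongDual.exists_norm_apply_le_of_seminorm [PolynormableSpace 𝕜 E]
    (x'' : StrongDual 𝕜 (StrongDual 𝕜 E))
    {r : Seminorm 𝕜 E} (hr : Continuous r) :
    ∃ C, ∀ φ : StrongDual 𝕜 E, (∀ v, ‖φ v‖ ≤ r v) → ‖x'' φ‖ ≤ C := by
  have hU : {φ : StrongDual 𝕜 E | ‖x'' φ‖ < 1} ∈ 𝓝 (0 : StrongDual 𝕜 E) := by
    have : Tendsto (fun φ => ‖x'' φ‖) (𝓝 0) (𝓝 0) := by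
      simpa using (x''.continuous.tendsto 0).norm
    exact this.eventually_lt_const one_pos
  obtain ⟨⟨B, ε⟩, ⟨hB, hε⟩, hBU⟩ := (ContinuousLinearMap.hasBasis_nhds_zero_of_basis
    (σ := RingHom.id 𝕜) (E := E) (Metric.nhds_basis_ball (x := (0 : 𝕜)))).mem_iff.1 hU
  simp only at hB hε hBU
  obtain ⟨R, hR, hBR⟩ := ((PolynormableSpace.withSeminorms 𝕜 E).isVonNBounded_iff_seminorm_bounded
    |>.1 hB) ⟨r, hr⟩
  -- As `r < R` on `B`, the multiple `(ε / R) φ` maps `B` into the `ε`-ball, where `hBU` applies.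
  refine ⟨R / ε, fun φ hφ => ?_⟩
  have hc : ‖((ε / R : ℝ) : 𝕜)‖ = ε / R := by
    rw [RCLike.norm_ofReal, abs_of_pos (by positivity)]
  have hmem : ((ε / R : ℝ) : 𝕜) • φ ∈ {φ : StrongDual 𝕜 E | ‖x'' φ‖ < 1} := by
    refine hBU fun v hv => ?_
    rw [mem_ball_zero_iff, smul_apply, norm_smul, hc, div_mul_eq_mul_div,
      div_lt_iff₀ hR]
    exact mul_lt_mul_of_pos_left ((hφ v).trans_lt (hBR v hv)) hε
  rw [Set.mem_ofPred_eq, map_smul, norm_smul, hc, div_mul_eq_mul_div, div_lt_one hR] at hmem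
  rw [le_div_iff₀ hε, mul_comm]
  exact hmem.le

end TopologicalSpace

variable {𝕜 E : Type*} [RCLike 𝕜] [AddCommGroup E] [Module 𝕜 E] [UniformSpace E]
  [IsUniformAddGroup E]

theorem Seminorm.bddAbove_range_sum_of_summable {q : Seminorm 𝕜 E} (hq : Continuous q)
    {ι : Type*} {z : ι → E} (hz : Summable z) :
    BddAbove (Set.range fun F : Finset ι => q (∑ j ∈ F, z j)) := by
  classical
  have hU : {v | q v < 1} ∈ 𝓝 (0 : E) :=
    (hq.tendsto' 0 0 (map_zero q)).eventually_lt_const one_pos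
  obtain ⟨s, hs⟩ := hz.vanishing hU
  refine ⟨1 + ∑ j ∈ s, q (z j), ?_⟩
  rintro _ ⟨F, rfl⟩
  have h1 : q (∑ j ∈ F \ s, z j) ≤ 1 := (hs _ Finset.sdiff_disjoint).le
  have h2 : q (∑ j ∈ F ∩ s, z j) ≤ ∑ j ∈ s, q (z j) :=
    (Finset.le_sum_of_subadditive q (map_zero q).le (map_add_le_add q) _ _).trans
      (Finset.sum_le_sum_of_subset_of_nonneg Finset.inter_subset_right
        fun _ _ _ => apply_nonneg q _)
  have h3 := map_add_le_add q (∑ j ∈ F ∩ s, z j) (∑ j ∈ F \ s, z j)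
  rw [Finset.sum_inter_add_sum_sdiff] at h3
  simp only
  linarith

variable [ContinuousSMul 𝕜 E] [PolynormableSpace 𝕜 E] [BarrelledSpace 𝕜 E]

/-- In a barrelled space, pointwise bounded families of operators are equicontinuous. -/
theorem BarrelledSpace.exists_seminorm_le {ι : Type*} {P : ι → E →L[𝕜] E} {q : Seminorm 𝕜 E}
    (hP : ∀ q : Seminorm 𝕜 E, Continuous q → ∀ v, BddAbove (Set.range fun i => q (P i v)))
    (hq : Continuous q) : ∃ r : Seminorm 𝕜 E, Continuous r ∧ ∀ i v, q (P i v) ≤ r v := by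
  have hw := PolynormableSpace.withSeminorms 𝕜 E
  obtain ⟨r, hr, h⟩ := (hw.uniformEquicontinuous_iff_exists_continuous_seminorm
    (fun i => (P i).toLinearMap)).1 (hw.banach_steinhaus fun k v => hP k.1 k.2 v) ⟨q, hq⟩
  exact ⟨r, hr, fun i v => h i v⟩

variable {x' : ℕ → StrongDual 𝕜 E} {x : ℕ → E}

/-- Unconditionality makes the partial sums over all finite sets, not only initial segments,
pointwise bounded; Banach–Steinhaus does the rest. -/
theorem IsUnconditionalAtomicDecomposition.exists_seminorm_le
    (hx : IsUnconditionalAtomicDecomposition x' x) {q : Seminorm 𝕜 E} (hq : Continuous q) :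
    ∃ r : Seminorm 𝕜 E, Continuous r ∧ ∀ (F : Finset ℕ) v, q (∑ j ∈ F, x' j v • x j) ≤ r v := by
  obtain ⟨r, hr, h⟩ := BarrelledSpace.exists_seminorm_le
    (P := fun F : Finset ℕ => ∑ j ∈ F, (x' j).smulRight (x j)) (fun q hq v => by
      simpa using Seminorm.bddAbove_range_sum_of_summable hq (hx.2 v).summable) hq
  exact ⟨r, hr, fun F v => by simpa using h F v⟩

/-- If `E` contains no copy of `c₀`, the bidual series of an unconditional atomic decomposition
converge unconditionally. -/
theorem IsUnconditionalAtomicDecomposition.summable_bidual [CompleteSpace E] [T2Space E]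
    (hx : IsUnconditionalAtomicDecomposition x' x) (hE : ¬ ContainsCopyOfC0 𝕜 E)
    (x'' : StrongDual 𝕜 (StrongDual 𝕜 E)) : Summable fun j => x'' (x' j) • x j := by
  classical
  by_contra hns
  rw [summable_iff_vanishing] at hns
  push Not at hns
  obtain ⟨U, hU, hbad⟩ := hns
  obtain ⟨p, hp, hpU⟩ := exists_continuous_seminorm_lt_one_imp_mem 𝕜 hU
  choose t htdisj ht using hbad
  -- `s k` collects the blocks chosen so far, so each new block `t (s k)` avoids all earlier ones.
  let s : ℕ → Finset ℕ := fun k => (fun s => s ∪ t s)^[k] ∅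
  have hsucc : ∀ k, s (k + 1) = s k ∪ t (s k) := fun k =>
    Function.iterate_succ_apply' (fun s => s ∪ t s) k ∅
  have hmono : Monotone s := monotone_nat_of_le_succ fun k => by
    rw [hsucc]; exact Finset.subset_union_left
  have hdisj : Pairwise fun k l => Disjoint (t (s k)) (t (s l)) := by
    refine (pairwise_disjoint_on fun k => t (s k)).2 fun k l hkl => ?_
    refine ((htdisj (s l)).mono_right ?_).symm
    refine le_trans ?_ (hmono (Nat.succ_le_of_lt hkl))
    rw [Nat.succ_eq_add_one, hsucc]
    exact Finset.subset_union_right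
  refine hE (containsCopyOfC0_of_sum_norm_le
    (y := fun k => ∑ j ∈ t (s k), x'' (x' j) • x j) ?_ hp fun k => ?_)
  · intro q hq
    obtain ⟨r, hr, hqr⟩ := hx.exists_seminorm_le hq
    obtain ⟨C, hC⟩ := x''.exists_norm_apply_le_of_seminorm hr
    refine ⟨4 * C, fun u hu F => Finset.sum_norm_le_four_mul fun G _ => ?_⟩
    -- A sum of blocks is again a finite partial sum, so one constant `C` serves for all `G`.
    rw [← map_sum, ← Finset.sum_biUnion fun k _ l _ hkl => hdisj hkl,
      StrongDual.apply_sum_bidual_smul]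
    exact hC _ (StrongDual.norm_sum_smul_apply_le (hqr _) hu)
  · by_contra hlt
    exact ht (s k) (hpU _ (not_le.1 hlt))

end Bidual

/-! ### Copies of `c₀` and bounded completeness -/

section NullSequences

variable {𝕜 : Type*} [RCLike 𝕜]

/-- The unit vectors of `c₀`. -/
noncomputable def ZeroAtInftyContinuousMap.unitVector (𝕜 : Type*) [RCLike 𝕜] (n : ℕ) :
    C₀(ℕ, 𝕜) where
  toFun := Pi.single n 1
  continuous_toFun := continuous_of_discreteTopology
  zero_at_infty' := by
    rw [Filter.cocompact_eq_cofinite]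
    refine tendsto_const_nhds.congr' ?_
    filter_upwards [(Set.finite_singleton n).compl_mem_cofinite] with m hm
    exact (Pi.single_eq_of_ne (M := fun _ => 𝕜) hm 1).symm

open ZeroAtInftyContinuousMap (unitVector)

theorem ZeroAtInftyContinuousMap.norm_sum_unitVector_le (F : Finset ℕ) :
    ‖∑ n ∈ F, unitVector 𝕜 n‖ ≤ 1 := by
  rw [ZeroAtInftyContinuousMap.norm_le zero_le_one]
  intro m
  have h : (∑ n ∈ F, unitVector 𝕜 n) m = ∑ n ∈ F, unitVector 𝕜 n m := by
    induction F using Finset.cons_induction with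
    | empty => simp
    | cons a s ha ih => rw [Finset.sum_cons, Finset.sum_cons, ZeroAtInftyContinuousMap.add_apply, ih]
  have h' : ∀ n, unitVector 𝕜 n m = if m = n then 1 else 0 := fun n => Pi.single_apply n 1 m
  rw [h]
  simp only [h', Finset.sum_ite_eq]
  split_ifs <;> simp

theorem ZeroAtInftyContinuousMap.one_le_norm_unitVector (n : ℕ) : 1 ≤ ‖unitVector 𝕜 n‖ := by
  have h : unitVector 𝕜 n n = 1 := Pi.single_eq_same n 1
  simpa [h] using (unitVector 𝕜 n).norm_apply_le n

/-- A crude form of `c₀' = ℓ¹`; the factor 4 is harmless, as only boundedness is needed. -/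
theorem StrongDual.sum_norm_apply_unitVector_le (g : StrongDual 𝕜 C₀(ℕ, 𝕜)) (F : Finset ℕ) :
    ∑ n ∈ F, ‖g (unitVector 𝕜 n)‖ ≤ 4 * ‖g‖ :=
  Finset.sum_norm_le_four_mul fun G _ => by
    rw [← map_sum]
    exact g.le_of_opNorm_le_of_le le_rfl (ZeroAtInftyContinuousMap.norm_sum_unitVector_le G)
      |>.trans_eq (mul_one _)

theorem StrongDual.summable_indicator_apply_unitVector (g : StrongDual 𝕜 C₀(ℕ, 𝕜)) (A : Set ℕ) :
    Summable (A.indicator fun n => g (unitVector 𝕜 n)) :=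
  (Summable.of_norm (summable_of_sum_le (fun _ => norm_nonneg _)
    g.sum_norm_apply_unitVector_le)).indicator A

theorem StrongDual.norm_tsum_indicator_apply_unitVector_le (g : StrongDual 𝕜 C₀(ℕ, 𝕜))
    (A : Set ℕ) : ‖∑' n, A.indicator (fun n => g (unitVector 𝕜 n)) n‖ ≤ 4 * ‖g‖ :=
  le_of_tendsto (g.summable_indicator_apply_unitVector A).hasSum.norm
    (Eventually.of_forall fun F => (norm_sum_le _ _).trans <|
      (Finset.sum_le_sum fun n _ => norm_indicator_le_norm_self _ n).trans
        (g.sum_norm_apply_unitVector_le F))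

/-- The element `𝟙_A` of `ℓ^∞`, the bidual of `c₀`. -/
noncomputable def bidualIndicator (𝕜 : Type*) [RCLike 𝕜] (A : Set ℕ) :
    StrongDual 𝕜 (StrongDual 𝕜 C₀(ℕ, 𝕜)) :=
  LinearMap.mkContinuous
    { toFun := fun g : StrongDual 𝕜 C₀(ℕ, 𝕜) => ∑' n, A.indicator (fun n => g (unitVector 𝕜 n)) n
      map_add' := fun g h => by
        rw [← (g.summable_indicator_apply_unitVector A).tsum_add
          (h.summable_indicator_apply_unitVector A)]
        simp only [add_apply, Set.indicator_add]
      map_smul' := fun c g => by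
        rw [RingHom.id_apply, ← (g.summable_indicator_apply_unitVector A).tsum_const_smul]
        simp only [smul_apply, Set.indicator_const_smul] } 4
    fun g => g.norm_tsum_indicator_apply_unitVector_le A

theorem bidualIndicator_apply (A : Set ℕ) (g : StrongDual 𝕜 C₀(ℕ, 𝕜)) :
    bidualIndicator 𝕜 A g = ∑' n, A.indicator (fun n => g (unitVector 𝕜 n)) n := rfl

theorem norm_bidualIndicator_apply_le (A : Set ℕ) (g : StrongDual 𝕜 C₀(ℕ, 𝕜)) :
    ‖bidualIndicator 𝕜 A g‖ ≤ 4 * ‖g‖ :=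
  g.norm_tsum_indicator_apply_unitVector_le A

theorem bidualIndicator_union {A B : Set ℕ} (h : Disjoint A B) :
    bidualIndicator 𝕜 (A ∪ B) = bidualIndicator 𝕜 A + bidualIndicator 𝕜 B := by
  ext g
  simp only [add_apply, bidualIndicator_apply]
  rw [Set.indicator_union_of_disjoint h]
  exact (g.summable_indicator_apply_unitVector A).tsum_add
    (g.summable_indicator_apply_unitVector B)

theorem bidualIndicator_singleton_apply (n : ℕ) (g : StrongDual 𝕜 C₀(ℕ, 𝕜)) :
    bidualIndicator 𝕜 {n} g = g (unitVector 𝕜 n) := by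
  rw [bidualIndicator_apply, tsum_eq_single n fun m hm => Set.indicator_of_notMem (by simpa) _]
  simp

end NullSequences

/-! ### Separability against copies of `c₀`, and the equivalence -/

section Main

open ZeroAtInftyContinuousMap (unitVector)

variable {𝕜 E : Type*} [RCLike 𝕜] [AddCommGroup E] [Module 𝕜 E] [UniformSpace E]
  [IsUniformAddGroup E]

theorem IsAtomicDecomposition.separableSpace [ContinuousSMul 𝕜 E] {x' : ℕ → StrongDual 𝕜 E} {x : ℕ → E}
    (hx : IsAtomicDecomposition x' x) : TopologicalSpace.SeparableSpace E := by
  have hsep : TopologicalSpace.IsSeparable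
      (closure (Submodule.span 𝕜 (Set.range x) : Set E)) :=
    ((Set.countable_range x).isSeparable.span).closure
  rw [← TopologicalSpace.isSeparable_univ_iff]
  refine hsep.mono fun v _ => mem_closure_of_tendsto (hx v) (Eventually.of_forall fun n => ?_)
  exact Submodule.sum_mem _ fun j _ => Submodule.smul_mem _ _ (Submodule.subset_span ⟨j, rfl⟩)

variable [PolynormableSpace 𝕜 E]

/-- A bounded finitely additive `E`-valued measure on the subsets of `ℕ` whose values at
singletons are bounded below in a continuous seminorm has a nonseparable range. -/
theorem not_separableSpace_of_additive {S : Set ℕ → E}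
    (hadd : ∀ A B, Disjoint A B → S (A ∪ B) = S A + S B) {p : Seminorm 𝕜 E} (hp : Continuous p)
    {K : ℝ} (hK : ∀ A, p (S A) ≤ K) (hone : ∀ n, 1 ≤ p (S {n})) :
    ¬ TopologicalSpace.SeparableSpace E := by
  intro hsep
  choose u hu hun using fun n => Seminorm.exists_strongDual_apply_eq hp (𝕜 := 𝕜) (S {n})
  let g : ℕ → Set ℕ → ℝ := fun n A => RCLike.re (u n (S A))
  have hg : ∀ n A B, Disjoint A B → g n (A ∪ B) = g n A + g n B := fun n A B h => by
    simp only [g, hadd A B h, map_add]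
  obtain ⟨ψ, hψ, h⟩ := exists_injective_abs_apply_le_of_additive (g := g) (M := K) (ε := 1 / 4)
    (by norm_num) hg fun n A => (RCLike.abs_re_le_norm _).trans ((hu n _).trans (hK A))
  -- The functional at `ψ k` sees at least 1 from the point `ψ k` and at most 1/4 from each of the
  -- two remainders, which leaves 1/2.
  have hsepd : ∀ A B : Set ℕ, ∀ k ∈ A, k ∉ B → 1 / 2 ≤ p (S (ψ '' A) - S (ψ '' B)) := by
    intro A B k hkA hkB
    have h1 : g (ψ k) (ψ '' A) = g (ψ k) {ψ k} + g (ψ k) (ψ '' A \ {ψ k}) := by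
      rw [← hg _ _ _ Set.disjoint_sdiff_right, Set.union_sdiff_cancel]
      exact Set.singleton_subset_iff.2 ⟨k, hkA, rfl⟩
    have h2 : 1 ≤ g (ψ k) {ψ k} := by
      simp only [g, hun, RCLike.ofReal_re]
      exact hone _
    have h3 := abs_le.1 (h k (ψ '' A \ {ψ k})
      (Set.sdiff_subset_sdiff_left (Set.image_subset_range ψ A)))
    have h4 := abs_le.1 (h k (ψ '' B) fun m hm => ⟨Set.image_subset_range ψ B hm, by
      rintro rfl
      exact hkB ((hψ.mem_set_image).1 hm)⟩)
    have h5 : g (ψ k) (ψ '' A) - g (ψ k) (ψ '' B) ≤ p (S (ψ '' A) - S (ψ '' B)) := by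
      simp only [g]
      rw [← map_sub, ← map_sub]
      exact (RCLike.re_le_norm _).trans (hu _ _)
    linarith [h3.1, h4.2]
  have hsep' : ∀ A B : Set ℕ, A ≠ B → 1 / 2 ≤ p (S (ψ '' A) - S (ψ '' B)) := by
    intro A B hAB
    by_cases hsub : A ⊆ B
    · obtain ⟨k, hkB, hkA⟩ := Set.not_subset.1 fun hBA => hAB (hsub.antisymm hBA)
      rw [map_sub_rev]
      exact hsepd B A k hkB hkA
    · obtain ⟨k, hkA, hkB⟩ := Set.not_subset.1 hsub
      exact hsepd A B k hkA hkB
  -- The open `p`-balls of radius 1/4 about these values are disjoint, and a separable space has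
  -- only countably many such sets.
  have hcount : Countable (Set ℕ) := by
    refine Pairwise.countable_of_isOpen_disjoint
      (s := fun A : Set ℕ => {v : E | p (v - S (ψ '' A)) < 1 / 4}) (fun A B hAB => ?_)
      (fun A => isOpen_lt (hp.comp (continuous_id.sub continuous_const)) continuous_const)
      (fun A => ⟨S (ψ '' A), by simp⟩)
    refine Set.disjoint_left.2 fun v (hA : p (v - _) < 1 / 4) (hB : p (v - _) < 1 / 4) => ?_
    have h1 := hsep' A B hAB
    have h2 := map_sub_le_add p (v - S (ψ '' B)) (v - S (ψ '' A))
    rw [sub_sub_sub_cancel_left] at h2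
    linarith
  obtain ⟨f, hf⟩ := hcount
  exact Function.cantor_injective f hf

variable [ContinuousSMul 𝕜 E] [BarrelledSpace 𝕜 E] [T2Space E] {x' : ℕ → StrongDual 𝕜 E} {x : ℕ → E}

theorem IsUnconditionalAtomicDecomposition.not_containsCopyOfC0
    (hx : IsUnconditionalAtomicDecomposition x' x)
    (hb : IsBoundedlyCompleteAtomicDecomposition x' x) : ¬ ContainsCopyOfC0 𝕜 E := by
  rintro ⟨T, hT⟩
  -- `X A` is the image of `𝟙_A` under the bitranspose of `T`.
  let X : Set ℕ → StrongDual 𝕜 (StrongDual 𝕜 E) := fun A =>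
    (bidualIndicator 𝕜 A).comp (ContinuousLinearMap.precomp 𝕜 T)
  have hX : ∀ A (u : StrongDual 𝕜 E), X A u = bidualIndicator 𝕜 A (u.comp T) := fun A u => rfl
  choose S hS using fun A => hb.2 (X A)
  obtain ⟨p, hp, hpT⟩ := Seminorm.exists_le_comp_of_isInducing (p := normSeminorm 𝕜 C₀(ℕ, 𝕜))
    continuous_norm (f := T.toLinearMap) hT.isInducing
  have hsingle : ∀ n, S {n} = T (unitVector 𝕜 n) := fun n => by
    refine tendsto_nhds_unique (hS {n}) ?_
    simp only [hX, bidualIndicator_singleton_apply]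
    exact hx.1 (T (unitVector 𝕜 n))
  obtain ⟨r, hr, hpr⟩ := hx.exists_seminorm_le hp
  obtain ⟨C, hC, hrC⟩ := (r.comp T.toLinearMap).bound_of_continuous_normedSpace
    (hr.comp T.continuous)
  -- In `4 * C`, the 4 bounds `𝟙_A` on `c₀'`, and `C` is the norm bound for `r ∘ T`, where `r`
  -- dominates all partial sums in `p`.
  refine not_separableSpace_of_additive (S := S) ?_ hp (K := 4 * C) (fun A => ?_) (fun n => ?_)
    hx.1.separableSpace
  · intro A B hAB
    refine tendsto_nhds_unique (hS (A ∪ B)) (((hS A).add (hS B)).congr fun n => ?_)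
    rw [← Finset.sum_add_distrib]
    refine Finset.sum_congr rfl fun j _ => ?_
    simp only [hX, bidualIndicator_union hAB, add_apply, add_smul]
  · refine le_of_tendsto ((hp.tendsto _).comp (hS A)) (Eventually.of_forall fun n => ?_)
    obtain ⟨u, hu, huv⟩ := Seminorm.exists_strongDual_apply_eq hp (𝕜 := 𝕜)
      (∑ j ∈ Finset.range n, X A (x' j) • x j)
    have h1 : p (∑ j ∈ Finset.range n, X A (x' j) • x j)
        = ‖u (∑ j ∈ Finset.range n, X A (x' j) • x j)‖ := by
      rw [huv, RCLike.norm_ofReal, abs_of_nonneg (apply_nonneg p _)]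
    rw [Function.comp_apply, h1, StrongDual.apply_sum_bidual_smul, hX]
    refine (norm_bidualIndicator_apply_le A _).trans
      (mul_le_mul_of_nonneg_left ?_ (by norm_num))
    refine ContinuousLinearMap.opNorm_le_bound _ hC.le fun a => ?_
    exact (StrongDual.norm_sum_smul_apply_le (hpr _) hu (T a)).trans (hrC a)
  · rw [hsingle]
    exact (ZeroAtInftyContinuousMap.one_le_norm_unitVector n).trans (hpT (unitVector 𝕜 n))

end Main

-- For the order on `𝕜`, convexity over `𝕜` and over `ℝ` coincide, so a real convex basis at zero
-- also serves over `𝕜`.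
open scoped ComplexOrder in
theorem PolynormableSpace.of_locallyConvexSpace_real {𝕜 E : Type*} [RCLike 𝕜] [AddCommGroup E]
    [Module 𝕜 E] [Module ℝ E] [IsScalarTower ℝ 𝕜 E] [TopologicalSpace E]
    [IsTopologicalAddGroup E] [ContinuousSMul 𝕜 E] [ContinuousSMul ℝ E]
    [LocallyConvexSpace ℝ E] : PolynormableSpace 𝕜 E := by
  have : LocallyConvexSpace 𝕜 E :=
    .ofBasisZero 𝕜 E _ _ (LocallyConvexSpace.convex_basis_zero ℝ E) fun s hs =>
      convex_RCLike_iff_convex_real.2 hs.2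
  infer_instance

theorem mainTheorem1 {𝕜 E : Type*} [RCLike 𝕜] [AddCommGroup E] [Module 𝕜 E]
    [Module ℝ E] [IsScalarTower ℝ 𝕜 E]
    [UniformSpace E] [IsUniformAddGroup E] [ContinuousSMul 𝕜 E]
    [LocallyConvexSpace ℝ E] [T2Space E] [CompleteSpace E] [BarrelledSpace 𝕜 E]
    (x' : ℕ → StrongDual 𝕜 E) (x : ℕ → E)
    (hx : IsUnconditionalAtomicDecomposition x' x) :
    IsBoundedlyCompleteAtomicDecomposition x' x ↔ ¬ ContainsCopyOfC0 𝕜 E := by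
  have : ContinuousSMul ℝ E := IsScalarTower.continuousSMul 𝕜
  have : PolynormableSpace 𝕜 E := .of_locallyConvexSpace_real
  exact ⟨hx.not_containsCopyOfC0, fun hE =>
    ⟨hx.1, fun x'' => ⟨_, (hx.summable_bidual hE x'').hasSum.tendsto_sum_nat⟩⟩⟩
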